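/- For integers $k\ge 0$, $n\ge 1$ let $L(k,n)$ be the number of $k\times n$ Latin rectangles, i.e. of sequences of $k$ permutations of $\{1,\dots,n\}$ which, written as the rows of a $k\times n$ matrix, give a matrix with no repeated entry in any column. Then: 1. (Upper bound) For all $k\ge 0$ and $n\ge 1$, $$L(k,n)\le (n!)^k\prod_{t=1}^{k-1}\Bigl(1-\frac tn+4\,\frac{t^2}{n^2}\Bigr)^n .$$ 2. (Lower bound) For all $n\ge 1$ and $0\le k\le n$, $$(n!)^k\prod_{t=1}^{k-1}\Bigl(1-\frac tn\Bigr)^n\le L(k,n).$$ 3. (Asymptotics) For every sequence $k=k(n)$ of non-negative integers with $k(n)=o(n^{1/3})$ as $n\to\infty$, the upper bound in 1 is asymptotically tight, and the asymptotic formula for $L$ holds, i.e. $$L(k,n)\sim (n!)^k\prod_{t=1}^{k-1}\Bigl(1-\frac tn+4\,\frac{t^2}{n^2}\Bigr)^n \qquad\text{and}\qquad L(k,n)\sim (n!)^k\,e^{-\binom k2-\frac{k^3}{6n}} .$$ -/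

import Mathlib

open Filter Asymptotics
open scoped Nat

/-- A `k × n` Latin rectangle: a sequence of `k` permutations of an `n`-element set (the rows),
such that no column has a repeated entry. -/
def IsLatinRectangle {k n : ℕ} (R : Fin k → Equiv.Perm (Fin n)) : Prop :=
  ∀ j : Fin n, Function.Injective fun i : Fin k => R i j

/-- `latinCount k n` is the number `L(k, n)` of `k × n` Latin rectangles. -/
noncomputable def latinCount (k n : ℕ) : ℕ :=
  Nat.card {R : Fin k → Equiv.Perm (Fin n) // IsLatinRectangle R}

/-- The upper bound `(n!)^k ∏_{t=1}^{k-1} (1 - t/n + 4 t²/n²)^n`. -/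
noncomputable def latinUpper (k n : ℕ) : ℝ :=
  (n ! : ℝ) ^ k * ∏ t ∈ Finset.Ico 1 k, (1 - (t : ℝ) / n + 4 * ((t : ℝ) ^ 2 / (n : ℝ) ^ 2)) ^ n

/-- The lower bound `(n!)^k ∏_{t=1}^{k-1} (1 - t/n)^n`. -/
noncomputable def latinLower (k n : ℕ) : ℝ :=
  (n ! : ℝ) ^ k * ∏ t ∈ Finset.Ico 1 k, (1 - (t : ℝ) / n) ^ n

/-! Build the rectangle row by row. A row extending a t × n Latin rectangle is a permutation
avoiding a t-regular pattern: t values are forbidden in each column, and each value is forbidden in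
t columns. Bounds on the number of such permutations that depend only on t and n multiply up to the
two product bounds.

From above (`card_avoiding_le`), the constraints are imposed one column at a time. Switching values
shows that a still unconstrained column takes each given value with conditional probability at least
(1 - t/(n - 2t))/n, so the next constraint holds with probability at most 1 - (t/n)(1 - t/(n - 2t)).

From below (`card_avoiding_univ_ge`), the count is (n - t)^n times the permanent of a doubly
stochastic matrix, and van der Waerden's inequality applies. That inequality is proved by Gurvits'
method: the permanent is the multilinear coefficient of a stable product of linear forms, and
extracting the linear coefficient in one variable at a time costs a controlled factor of the
capacity.

If k^3/n tends to 0, then both products, and the claimed formula as well, agree with (n!)^k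
exp(-k(k-1)/2) up to a factor between exp(-4k^3/n) and exp(4k^3/n). -/

/-! ### Permutations avoiding a pattern: upper bound by switchings -/

section Avoiding

variable {α : Type*} [Fintype α] [DecidableEq α]

/-- The permutations `σ` with `σ a ∉ N a` for all `a ∈ S`. -/
def avoiding (N : α → Finset α) (S : Finset α) : Finset (Equiv.Perm α) :=
  {σ | ∀ a ∈ S, σ a ∉ N a}

lemma mem_avoiding {N : α → Finset α} {S : Finset α} {σ : Equiv.Perm α} :
    σ ∈ avoiding N S ↔ ∀ a ∈ S, σ a ∉ N a := by
  simp [avoiding]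

lemma avoiding_empty (N : α → Finset α) : avoiding N ∅ = Finset.univ := by
  ext; simp [avoiding]

/-- Switching: exchange the value `j` at `a` with another value `d`. At least n - 2t choices of `d`
keep every constraint, and they also keep `σ i = b`, because `b ∈ N a` rules out `d = b`. -/
lemma card_avoiding_two_values_mul_le {N : α → Finset α} {S : Finset α} {t : ℕ}
    (hrow : ∀ a, (N a).card ≤ t)
    (hcol : ∀ b, (Finset.univ.filter fun a => b ∈ N a).card ≤ t)
    {i a b j : α} (ha : a ∈ S) (hb : b ∈ N a) :
    ((avoiding N S).filter fun σ => σ i = b ∧ σ a = j).card * (Fintype.card α - 2 * t) ≤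
      ((avoiding N S).filter fun σ => σ i = b).card := by
  classical
  set X := (avoiding N S).filter fun σ => σ i = b ∧ σ a = j with hX
  -- Values `d` that `a` may not receive, or whose present position may not receive `j`.
  let bad : Equiv.Perm α → Finset α := fun σ =>
    N a ∪ (Finset.univ.filter fun c => j ∈ N c).image σ
  have hbad : ∀ σ, (bad σ).card ≤ 2 * t := fun σ => by
    refine (Finset.card_union_le _ _).trans ?_
    have := (Finset.card_image_le (s := Finset.univ.filter fun c => j ∈ N c) (f := σ)).trans
      (hcol j)
    have := hrow a
    omega
  have hgood : ∀ σ ∈ X, Fintype.card α - 2 * t ≤ ((bad σ)ᶜ).card := fun σ _ => by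
    rw [Finset.card_compl]
    have := hbad σ
    omega
  calc X.card * (Fintype.card α - 2 * t) ≤ ∑ σ ∈ X, ((bad σ)ᶜ).card := by
        rw [← smul_eq_mul]
        exact Finset.card_nsmul_le_sum _ _ _ hgood
    _ = (X.sigma fun σ => (bad σ)ᶜ).card := (Finset.card_sigma _ _).symm
    _ ≤ _ := by
        refine Finset.card_le_card_of_injOn (fun p => Equiv.swap j p.2 * p.1) ?_ ?_
        · rintro ⟨σ, d⟩ h
          simp only [hX, bad, Finset.coe_sigma, Set.mem_sigma_iff, Finset.mem_coe,
            Finset.mem_filter, mem_avoiding, Finset.mem_compl, Finset.mem_union, Finset.mem_image,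
            Finset.mem_univ, true_and, not_or, not_exists, not_and] at h ⊢
          obtain ⟨⟨hσ, hi, hj⟩, hd, hc⟩ := h
          have hja : j ∉ N a := hj ▸ hσ a ha
          refine ⟨fun c hcS => ?_, ?_⟩
          · rw [Equiv.Perm.mul_apply]
            by_cases h1 : σ c = d
            · rw [h1, Equiv.swap_apply_right]
              exact fun h => hc c h h1
            by_cases h2 : σ c = j
            · rw [h2, Equiv.swap_apply_left]
              rwa [σ.injective (h2.trans hj.symm)]
            · rw [Equiv.swap_apply_of_ne_of_ne h2 h1]
              exact hσ c hcS
          · rw [Equiv.Perm.mul_apply, hi, Equiv.swap_apply_of_ne_of_ne]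
            · rintro rfl; exact hja hb
            · rintro rfl; exact hd hb
        · rintro ⟨σ, d⟩ h ⟨τ, e⟩ h' heq
          simp only [hX, Finset.coe_sigma, Set.mem_sigma_iff, Finset.mem_coe,
            Finset.mem_filter] at h h' heq
          -- The switched permutation takes the value `d` at `a`, so `d` and then `σ` can be
          -- recovered.
          have hde : d = e := by
            have := congrArg (fun ρ : Equiv.Perm α => ρ a) heq
            simpa [h.1.2.2, h'.1.2.2] using this
          subst hde
          have := mul_left_cancel heq
          subst this
          rfl

/-- Exchanging the values `b` and `j` turns `σ i = b` into `σ i = j`. As `i` is unconstrained, it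
can only fail at the position `a` holding `j`, when `b` is forbidden there. -/
lemma card_avoiding_value_le {N : α → Finset α} {S : Finset α} {i : α} (hi : i ∉ S) (b j : α) :
    ((avoiding N S).filter fun σ => σ i = b).card ≤
      ((avoiding N S).filter fun σ => σ i = j).card +
        ∑ a ∈ S.filter fun a => b ∈ N a,
          ((avoiding N S).filter fun σ => σ i = b ∧ σ a = j).card := by
  classical
  set Y := (avoiding N S).filter fun σ => σ i = b
  rw [← Finset.card_filter_add_card_filter_not (s := Y)
    (fun σ => Equiv.swap b j * σ ∈ avoiding N S)]
  refine add_le_add ?_ ?_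
  · refine Finset.card_le_card_of_injOn (fun σ => Equiv.swap b j * σ) ?_
      fun σ _ τ _ h => mul_left_cancel h
    intro σ h
    simp only [Y, Finset.coe_filter, Finset.mem_filter, Set.mem_ofPred_eq] at h ⊢
    exact ⟨h.2, by simp [h.1.2]⟩
  · refine (Finset.card_le_card ?_).trans Finset.card_biUnion_le
    intro σ h
    simp only [Y, Finset.mem_filter, mem_avoiding, Finset.mem_biUnion, not_forall,
      not_not] at h ⊢
    obtain ⟨⟨hσ, hb⟩, a, ha, hN⟩ := h
    have hab : σ a ≠ b := fun h => hi (σ.injective (h.trans hb.symm) ▸ ha)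
    rw [Equiv.Perm.mul_apply] at hN
    by_cases haj : σ a = j
    · rw [haj, Equiv.swap_apply_right] at hN
      exact ⟨a, ⟨ha, hN⟩, hσ, hb, haj⟩
    · rw [Equiv.swap_apply_of_ne_of_ne hab haj] at hN
      exact absurd hN (hσ a ha)

lemma sum_card_avoiding_value (N : α → Finset α) (S : Finset α) (i : α) :
    ∑ b, ((avoiding N S).filter fun σ => σ i = b).card = (avoiding N S).card :=
  (Finset.card_eq_sum_card_fiberwise fun _ _ => Finset.mem_coe.2 (Finset.mem_univ _)).symm

/-- Sum the switching inequality over all `b`. Each `b` has at most t exceptional positions `a`,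
each costing a fraction at most 1/(n - 2t) of the permutations with `σ i = b`. -/
lemma card_avoiding_mul_le_card_value {N : α → Finset α} {S : Finset α} {t : ℕ}
    (hrow : ∀ a, (N a).card ≤ t)
    (hcol : ∀ b, (Finset.univ.filter fun a => b ∈ N a).card ≤ t)
    (ht : 2 * t < Fintype.card α) {i : α} (hi : i ∉ S) (j : α) :
    ((avoiding N S).card : ℝ) * (1 - t / (Fintype.card α - 2 * t)) ≤
      Fintype.card α * ((avoiding N S).filter fun σ => σ i = j).card := by
  classical
  have hpos : (0 : ℝ) < Fintype.card α - 2 * t := by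
    have : ((2 * t : ℕ) : ℝ) < Fintype.card α := by exact_mod_cast ht
    push_cast at this
    linarith
  have key : ∀ b, (((avoiding N S).filter fun σ => σ i = b).card : ℝ) ≤
      ((avoiding N S).filter fun σ => σ i = j).card +
        t * (((avoiding N S).filter fun σ => σ i = b).card / (Fintype.card α - 2 * t)) := by
    intro b
    have h1 : (((avoiding N S).filter fun σ => σ i = b).card : ℝ) ≤
        ((avoiding N S).filter fun σ => σ i = j).card +
        ∑ a ∈ S.filter fun a => b ∈ N a,
          (((avoiding N S).filter fun σ => σ i = b ∧ σ a = j).card : ℝ) := by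
      exact_mod_cast card_avoiding_value_le hi b j
    refine h1.trans (add_le_add le_rfl ?_)
    have h2 : ∀ a ∈ S.filter fun a => b ∈ N a,
        (((avoiding N S).filter fun σ => σ i = b ∧ σ a = j).card : ℝ) ≤
          ((avoiding N S).filter fun σ => σ i = b).card / (Fintype.card α - 2 * t) := by
      intro a ha
      rw [Finset.mem_filter] at ha
      rw [le_div_iff₀ hpos]
      have h3 := card_avoiding_two_values_mul_le hrow hcol (i := i) (j := j) ha.1 ha.2
      have h4 : ((Fintype.card α - 2 * t : ℕ) : ℝ) = Fintype.card α - 2 * t := by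
        rw [Nat.cast_sub ht.le]; push_cast; rfl
      rw [← h4]
      exact_mod_cast h3
    refine (Finset.sum_le_card_nsmul _ _ _ h2).trans ?_
    rw [nsmul_eq_mul]
    refine mul_le_mul_of_nonneg_right ?_ (div_nonneg (Nat.cast_nonneg _) hpos.le)
    have : (S.filter fun a => b ∈ N a).card ≤ t :=
      (Finset.card_le_card (Finset.filter_subset_filter _ (Finset.subset_univ _))).trans (hcol b)
    exact_mod_cast this
  have hsum : (∑ b, (((avoiding N S).filter fun σ => σ i = b).card : ℝ)) =
      (avoiding N S).card := by
    exact_mod_cast sum_card_avoiding_value N S i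
  have := Finset.sum_le_sum fun b (_ : b ∈ Finset.univ) => key b
  rw [Finset.sum_add_distrib, ← Finset.mul_sum, ← Finset.sum_div, hsum, Finset.sum_const,
    Finset.card_univ, nsmul_eq_mul] at this
  have e : (t : ℝ) * ((avoiding N S).card / (Fintype.card α - 2 * t)) =
    (avoiding N S).card * (t / (Fintype.card α - 2 * t)) := by ring
  linarith

lemma card_avoiding_insert {N : α → Finset α} {S : Finset α} {i : α} :
    (avoiding N (insert i S)).card +
      ∑ j ∈ N i, ((avoiding N S).filter fun σ => σ i = j).card = (avoiding N S).card := by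
  classical
  have h : ∑ j ∈ N i, ((avoiding N S).filter fun σ => σ i = j).card =
      ((avoiding N S).filter fun σ => σ i ∈ N i).card := by
    rw [Finset.card_eq_sum_card_fiberwise (s := (avoiding N S).filter fun σ => σ i ∈ N i)
      (f := fun σ => σ i) (t := N i) (fun σ hσ => by
        simpa using (Finset.mem_filter.1 (Finset.mem_coe.1 hσ)).2)]
    refine Finset.sum_congr rfl fun j hj => ?_
    congr 1
    ext σ
    simp only [Finset.mem_filter]
    constructor
    · rintro ⟨h1, rfl⟩; exact ⟨⟨h1, hj⟩, rfl⟩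
    · rintro ⟨⟨h1, _⟩, h2⟩; exact ⟨h1, h2⟩
  rw [h, add_comm, ← Finset.card_filter_add_card_filter_not (s := avoiding N S)
    (fun σ => σ i ∈ N i)]
  congr 2
  ext σ
  simp [mem_avoiding, and_comm]

/-- A permutation avoids a `t`-regular pattern in all rows with probability at most
`(1 - x + x² / (1 - 2x)) ^ n`, `x = t / n`. -/
lemma card_avoiding_le {N : α → Finset α} {t : ℕ} (hrow : ∀ a, (N a).card = t)
    (hcol : ∀ b, (Finset.univ.filter fun a => b ∈ N a).card ≤ t)
    (ht : 2 * t < Fintype.card α) (S : Finset α) :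
    ((avoiding N S).card : ℝ) ≤ (Fintype.card α)! *
      (1 - t / Fintype.card α * (1 - t / (Fintype.card α - 2 * t))) ^ S.card := by
  classical
  have hn : (0 : ℝ) < Fintype.card α := by exact_mod_cast (by omega : 0 < Fintype.card α)
  have hpos : (0 : ℝ) < Fintype.card α - 2 * t := by
    have : ((2 * t : ℕ) : ℝ) < Fintype.card α := by exact_mod_cast ht
    push_cast at this
    linarith
  have hnn : 0 ≤ 1 - (t : ℝ) / Fintype.card α * (1 - t / (Fintype.card α - 2 * t)) := by
    have h1 : (t : ℝ) / Fintype.card α ≤ 1 := by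
      rw [div_le_one hn]
      have : (0 : ℝ) ≤ t := Nat.cast_nonneg _
      linarith
    have h2 : (0 : ℝ) ≤ t / Fintype.card α := by positivity
    have h3 : (0 : ℝ) ≤ t / (Fintype.card α - 2 * t) := by positivity
    nlinarith
  induction S using Finset.induction_on with
  | empty => simp [avoiding_empty, Finset.card_univ, Fintype.card_perm]
  | insert i S hi ih =>
    rw [Finset.card_insert_of_notMem hi, pow_succ, ← mul_assoc]
    refine le_trans ?_ (mul_le_mul_of_nonneg_right ih hnn)
    have h1 : ((avoiding N (insert i S)).card : ℝ) +
        ∑ j ∈ N i, (((avoiding N S).filter fun σ => σ i = j).card : ℝ) =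
          (avoiding N S).card := by
      exact_mod_cast card_avoiding_insert
    have h2 : ∑ j ∈ N i, (((avoiding N S).card : ℝ) * (1 - t / (Fintype.card α - 2 * t)) /
        Fintype.card α) ≤
        ∑ j ∈ N i, (((avoiding N S).filter fun σ => σ i = j).card : ℝ) := by
      refine Finset.sum_le_sum fun j _ => ?_
      rw [div_le_iff₀' hn]
      exact card_avoiding_mul_le_card_value (fun a => (hrow a).le) hcol ht hi j
    rw [Finset.sum_const, hrow, nsmul_eq_mul] at h2
    have e : ((avoiding N S).card : ℝ) *
        (1 - t / Fintype.card α * (1 - t / (Fintype.card α - 2 * t))) =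
        (avoiding N S).card - t * (((avoiding N S).card : ℝ) *
          (1 - t / (Fintype.card α - 2 * t)) / Fintype.card α) := by ring
    rw [e]
    linarith

lemma card_avoiding_univ_le {N : α → Finset α} {t : ℕ} (hrow : ∀ a, (N a).card = t)
    (hcol : ∀ b, (Finset.univ.filter fun a => b ∈ N a).card ≤ t) :
    ((avoiding N Finset.univ).card : ℝ) ≤ (Fintype.card α)! *
      (1 - t / Fintype.card α + 4 * ((t : ℝ) ^ 2 / (Fintype.card α : ℝ) ^ 2)) ^
        Fintype.card α := by
  rcases Nat.eq_zero_or_pos (Fintype.card α) with h0 | hpos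
  · have : IsEmpty α := Fintype.card_eq_zero_iff.1 h0
    refine le_trans (b := ((Fintype.card α)! : ℝ)) ?_ (by simp)
    rw [← Fintype.card_perm]
    exact_mod_cast Finset.card_le_univ _
  have hn : (0 : ℝ) < Fintype.card α := by exact_mod_cast hpos
  have hsq : (t : ℝ) ^ 2 / (Fintype.card α : ℝ) ^ 2 = (t / Fintype.card α) ^ 2 := by
    rw [div_pow]
  rw [hsq]
  -- With x = t/n, the factor 1 - x + 4x² is at least 1 exactly when x = 0 or x ≥ 1/4, so for x ≥
  -- 1/4 the trivial bound n! suffices.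
  rcases lt_or_ge (4 * t) (Fintype.card α) with h | h
  · have ht : 2 * t < Fintype.card α := by omega
    refine (card_avoiding_le hrow hcol ht Finset.univ).trans ?_
    rw [Finset.card_univ]
    have hx : (t : ℝ) / Fintype.card α < 1 / 4 := by
      rw [div_lt_iff₀ hn]
      have : ((4 * t : ℕ) : ℝ) < Fintype.card α := by exact_mod_cast h
      push_cast at this
      linarith
    have e : (t : ℝ) / (Fintype.card α - 2 * t) =
        (t / Fintype.card α) / (1 - 2 * (t / Fintype.card α)) := by
      field_simp
    rw [e]
    have hx0 : (0 : ℝ) ≤ t / Fintype.card α := by positivity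
    generalize (t : ℝ) / Fintype.card α = x at hx hx0
    have h1 : x / (1 - 2 * x) ≤ 4 * x := by
      rw [div_le_iff₀ (by linarith)]
      nlinarith
    have h2 : 0 ≤ x / (1 - 2 * x) := div_nonneg hx0 (by linarith)
    refine mul_le_mul_of_nonneg_left (pow_le_pow_left₀ ?_ ?_ _) (Nat.cast_nonneg _)
    · nlinarith
    · nlinarith
  · have hx : 1 / 4 ≤ (t : ℝ) / Fintype.card α := by
      rw [le_div_iff₀ hn]
      have : (Fintype.card α : ℝ) ≤ ((4 * t : ℕ) : ℝ) := by exact_mod_cast h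
      push_cast at this
      linarith
    generalize (t : ℝ) / Fintype.card α = x at hx
    calc ((avoiding N Finset.univ).card : ℝ) ≤ (Fintype.card α)! := by
          rw [← Fintype.card_perm]
          exact_mod_cast Finset.card_le_univ _
      _ ≤ _ := le_mul_of_one_le_right (Nat.cast_nonneg _) (one_le_pow₀ (by nlinarith))

end Avoiding

/-! ### Univariate polynomials with roots in the left half-plane -/

section Univariate

lemma Multiset.prod_le_pow_mul_exp {M : ℝ} (hM : 0 < M) (s : Multiset ℝ) (hs : ∀ x ∈ s, 0 ≤ x) :
    s.prod ≤ M ^ s.card * Real.exp (s.sum / M - s.card) := by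
  induction s using Multiset.induction_on with
  | empty => simp
  | cons a s ih =>
    rw [Multiset.prod_cons, Multiset.card_cons, Multiset.sum_cons]
    have h1 : a ≤ M * Real.exp (a / M - 1) := by
      have := Real.add_one_le_exp (a / M - 1)
      rw [sub_add_cancel, div_le_iff₀' hM] at this
      exact this
    have h2 := ih fun x hx => hs x (Multiset.mem_cons_of_mem hx)
    have h3 : 0 ≤ s.prod :=
      Multiset.prod_nonneg fun x hx => hs x (Multiset.mem_cons_of_mem hx)
    refine (mul_le_mul h1 h2 h3 (by positivity)).trans_eq ?_
    rw [mul_mul_mul_comm, ← Real.exp_add, pow_succ']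
    congr 2
    push_cast
    ring

/-- The arithmetic-geometric mean inequality for multisets. -/
lemma Multiset.prod_le_mean_pow {s : Multiset ℝ} (hs : ∀ x ∈ s, 0 ≤ x) {M : ℝ} (hM : 0 < M)
    (hsum : s.sum = s.card * M) : s.prod ≤ M ^ s.card := by
  have := Multiset.prod_le_pow_mul_exp hM s hs
  rwa [hsum, mul_div_cancel_right₀ _ hM.ne', sub_self, Real.exp_zero, mul_one] at this

/-- Write R(t) = R(0) ∏(1 + t/|r|) over the roots r. The linear coefficient is R(0)β with β = ∑
1/|r|, and AM-GM bounds R(t) by R(0)(1 + tβ/(d+1))^(d+1). -/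
lemma Polynomial.Splits.capacity_le_coeff_one {R : Polynomial ℝ} (hR : R.Splits) {d : ℕ}
    (hd : 0 < d) (hdeg : R.natDegree = d + 1) (hroots : ∀ r ∈ R.roots, r < 0)
    (hlead : 0 < R.leadingCoeff) {c : ℝ} (hc : ∀ t, 0 < t → c * t ≤ R.eval t) :
    c * ((d : ℝ) / (d + 1)) ^ d ≤ R.coeff 1 := by
  have hd' : (0 : ℝ) < d := by exact_mod_cast hd
  have hcard : R.roots.card = d + 1 := by rw [← hR.natDegree_eq_card_roots, hdeg]
  set c₀ := R.eval 0 with hc₀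
  have hc₀pos : 0 < c₀ := by
    rw [hc₀, hR.eval_eq_prod_roots]
    refine mul_pos hlead (Multiset.prod_pos fun x hx => ?_)
    obtain ⟨r, hr, rfl⟩ := Multiset.mem_map.1 hx
    have := hroots r hr
    linarith
  set β := (R.roots.map fun z => 1 / (0 - z)).sum with hβ
  have hβpos : 0 < β := by
    obtain ⟨r, hr⟩ := Multiset.card_pos_iff_exists_mem.1 (by omega : 0 < R.roots.card)
    obtain ⟨s, hs⟩ := Multiset.exists_cons_of_mem hr
    have hpos : ∀ r ∈ R.roots, 0 < 1 / (0 - r) := fun r hr => by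
      have := hroots r hr
      exact div_pos one_pos (by linarith)
    rw [hβ, hs, Multiset.map_cons, Multiset.sum_cons]
    refine add_pos_of_pos_of_nonneg (hpos r hr) (Multiset.sum_nonneg fun x hx => ?_)
    obtain ⟨y, hy, rfl⟩ := Multiset.mem_map.1 hx
    exact (hpos y (hs ▸ Multiset.mem_cons_of_mem hy)).le
  have hc₁ : R.coeff 1 = c₀ * β := by
    rw [← hR.eval_derivative_eq_eval_mul_sum hc₀pos.ne', ← Polynomial.coeff_zero_eq_eval_zero,
      Polynomial.coeff_derivative]
    simp
  have heval : ∀ t, R.eval t = c₀ * (R.roots.map fun z => 1 + t * (1 / (0 - z))).prod := fun t => by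
    rw [hc₀, hR.eval_eq_prod_roots, hR.eval_eq_prod_roots, mul_assoc, ← Multiset.prod_map_mul]
    congr 2
    refine Multiset.map_congr rfl fun z hz => ?_
    have := (hroots z hz).ne
    field_simp
    ring
  -- This `t` minimises (1 + tβ/(d+1))^(d+1) / t; the mean of the factors becomes (d+1)/d.
  set t := ((d : ℝ) + 1) / (d * β) with ht
  have htpos : 0 < t := by positivity
  have hM : (0 : ℝ) < (d + 1) / d := by positivity
  have hle : (R.roots.map fun z => 1 + t * (1 / (0 - z))).prod ≤ (((d : ℝ) + 1) / d) ^ (d + 1) := by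
    have := Multiset.prod_le_mean_pow (s := R.roots.map fun z => 1 + t * (1 / (0 - z))) ?_ hM ?_
    · rwa [Multiset.card_map, hcard] at this
    · intro x hx
      obtain ⟨r, hr, rfl⟩ := Multiset.mem_map.1 hx
      have := hroots r hr
      have : 0 < 1 / (0 - r) := div_pos one_pos (by linarith)
      positivity
    · rw [Multiset.sum_map_add, Multiset.sum_map_mul_left, ← hβ, Multiset.card_map, hcard,
        Multiset.map_const', Multiset.sum_replicate, hcard, ht, nsmul_eq_mul]
      push_cast
      field_simp
  have h1 := hc t htpos
  rw [heval] at h1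
  have h2 := h1.trans (mul_le_mul_of_nonneg_left hle hc₀pos.le)
  rw [hc₁]
  have h3 : c * ((d : ℝ) / (d + 1)) ^ d = c * t * (β * ((d : ℝ) / (d + 1)) ^ (d + 1)) := by
    rw [ht, pow_succ]; field_simp
  rw [h3]
  refine (mul_le_mul_of_nonneg_right h2 (by positivity)).trans_eq ?_
  rw [mul_mul_mul_comm, ← mul_pow]
  have : ((d : ℝ) + 1) / d * (d / (d + 1)) = 1 := by field_simp
  rw [this, one_pow, mul_one]

/-- A nonconstant complex polynomial whose roots have negative real part has a nonzero linear
coefficient. -/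
lemma Polynomial.coeff_one_ne_zero_of_roots_re_neg {R : Polynomial ℂ} (hdeg : 0 < R.natDegree)
    (h : ∀ z : ℂ, 0 ≤ z.re → R.eval z ≠ 0) : R.coeff 1 ≠ 0 := by
  have hs := IsAlgClosed.splits R
  have h0 : R.eval 0 ≠ 0 := h 0 (by simp)
  have hc₁ : R.coeff 1 = R.eval 0 * (R.roots.map fun z => 1 / (0 - z)).sum := by
    rw [← hs.eval_derivative_eq_eval_mul_sum h0, ← Polynomial.coeff_zero_eq_eval_zero,
      Polynomial.coeff_derivative]
    simp
  rw [hc₁]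
  refine mul_ne_zero h0 fun hsum => ?_
  have hpos : ∀ z ∈ R.roots, 0 < (1 / (0 - z) : ℂ).re := fun z hz => by
    have hz' : z.re < 0 := by
      by_contra hcon
      exact h z (not_lt.1 hcon) (Polynomial.isRoot_of_mem_roots hz)
    rw [zero_sub, one_div, Complex.inv_re, Complex.neg_re, Complex.normSq_neg]
    refine div_pos (by linarith) (Complex.normSq_pos.2 ?_)
    rintro rfl
    simp at hz'
  obtain ⟨r, hr⟩ := Multiset.card_pos_iff_exists_mem.1
    (by rw [← hs.natDegree_eq_card_roots]; exact hdeg : 0 < R.roots.card)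
  obtain ⟨s, hs'⟩ := Multiset.exists_cons_of_mem hr
  have hre := congrArg Complex.reAddGroupHom hsum
  rw [map_multiset_sum, Multiset.map_map, hs', Multiset.map_cons, Multiset.sum_cons] at hre
  have : 0 ≤ (s.map (⇑Complex.reAddGroupHom ∘ fun z => 1 / (0 - z))).sum := by
    refine Multiset.sum_nonneg fun x hx => ?_
    obtain ⟨y, hy, rfl⟩ := Multiset.mem_map.1 hx
    exact (hpos y (hs' ▸ Multiset.mem_cons_of_mem hy)).le
  have hre' : (1 / (0 - r)).re +
      (s.map (⇑Complex.reAddGroupHom ∘ fun z => 1 / (0 - z))).sum = 0 := hre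
  have := hpos r hr
  linarith

end Univariate

/-! ### Stable polynomials and Gurvits' capacity inequality -/

section Stable

open MvPolynomial

/-- The univariate polynomial obtained from `p` by specialising all variables but the first. -/
noncomputable def slice {K : Type*} [CommRing K] [Algebra ℝ K] {m : ℕ} (z : Fin m → K)
    (p : MvPolynomial (Fin (m + 1)) ℝ) : Polynomial K :=
  (finSuccEquiv ℝ m p).map (aeval z : MvPolynomial (Fin m) ℝ →ₐ[ℝ] K).toRingHom

lemma coeff_slice {K : Type*} [CommRing K] [Algebra ℝ K] {m : ℕ} (z : Fin m → K)
    (p : MvPolynomial (Fin (m + 1)) ℝ) (k : ℕ) :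
    (slice z p).coeff k = aeval z ((finSuccEquiv ℝ m p).coeff k) := by
  simp [slice, Polynomial.coeff_map]

lemma eval_slice {K : Type*} [CommRing K] [Algebra ℝ K] {m : ℕ} (z : Fin m → K) (t : K)
    (p : MvPolynomial (Fin (m + 1)) ℝ) :
    (slice z p).eval t = aeval (Fin.cons t z : Fin (m + 1) → K) p := by
  induction p using MvPolynomial.induction_on with
  | C a => simp [slice, finSuccEquiv_apply]
  | add p q hp hq =>
    simp only [slice, map_add, Polynomial.map_add, Polynomial.eval_add] at *
    rw [hp, hq]
  | mul_X p i hp =>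
    simp only [slice, map_mul, Polynomial.map_mul, Polynomial.eval_mul] at *
    rw [hp]
    congr 1
    refine Fin.cases ?_ (fun j => ?_) i
    · simp [finSuccEquiv_X_zero]
    · simp [finSuccEquiv_X_succ]

/-- Real homogeneous polynomials of degree `k`, all of whose coefficients are positive, that do not
vanish at complex points with nonnegative real parts, not all zero. -/
structure IsPosStable {m : ℕ} (k : ℕ) (p : MvPolynomial (Fin m) ℝ) : Prop where
  homogeneous : p.IsHomogeneous k
  coeff_pos : ∀ d : Fin m →₀ ℕ, d.degree = k → 0 < p.coeff d
  ne_zero : ∀ z : Fin m → ℂ, (∀ i, 0 ≤ (z i).re) → (∃ i, 0 < (z i).re) → aeval z p ≠ 0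

lemma MvPolynomial.IsHomogeneous.aeval_smul {K : Type*} [CommRing K] [Algebra ℝ K] {m k : ℕ}
    {p : MvPolynomial (Fin m) ℝ} (hp : p.IsHomogeneous k) (u : K) (z : Fin m → K) :
    MvPolynomial.aeval (fun i => u * z i) p = u ^ k * MvPolynomial.aeval z p := by
  rw [aeval_def, aeval_def, eval₂_eq', eval₂_eq', Finset.mul_sum]
  refine Finset.sum_congr rfl fun d hd => ?_
  have hdeg : ∑ i, d i = k := by
    rw [← Finsupp.degree_eq_sum]
    by_contra h
    exact mem_support_iff.1 hd (hp.coeff_eq_zero h)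
  simp only [mul_pow]
  rw [Finset.prod_mul_distrib, Finset.prod_pow_eq_pow_sum, hdeg]
  ring

variable {m k : ℕ} {p : MvPolynomial (Fin (m + 1)) ℝ}

lemma Finsupp.degree_cons (i : ℕ) (d : Fin m →₀ ℕ) : (d.cons i).degree = i + d.degree := by
  simp [Finsupp.degree_eq_sum, Fin.sum_univ_succ]

namespace IsPosStable

/-- By homogeneity the top coefficient is a constant independent of `z`. Positivity of the
coefficients then keeps the degree of every slice equal to k, so no limiting argument is needed. -/
lemma coeff_slice_top (hp : IsPosStable k p) {K : Type*} [CommRing K] [Algebra ℝ K]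
    (z : Fin m → K) :
    (slice z p).coeff k = algebraMap ℝ K (p.coeff (Finsupp.cons k 0)) := by
  have h := hp.homogeneous.finSuccEquiv_coeff_isHomogeneous k 0 (add_zero k)
  have h' := (totalDegree_eq_zero_iff_eq_C (p := (finSuccEquiv ℝ m p).coeff k)).1
    (by simpa using h.totalDegree_le)
  rw [coeff_slice, h', finSuccEquiv_coeff_coeff, aeval_C]

lemma natDegree_slice (hp : IsPosStable k p) {K : Type*} [Field K] [Algebra ℝ K]
    (z : Fin m → K) : (slice z p).natDegree = k := by
  refine Polynomial.natDegree_eq_of_le_of_coeff_ne_zero ?_ ?_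
  · rw [Polynomial.natDegree_le_iff_coeff_eq_zero]
    intro j hj
    have : (finSuccEquiv ℝ m p).coeff j = 0 := by
      ext d
      rw [finSuccEquiv_coeff_coeff, coeff_zero]
      refine hp.homogeneous.coeff_eq_zero ?_
      rw [Finsupp.degree_cons]
      omega
    rw [coeff_slice, this, map_zero]
  · rw [hp.coeff_slice_top]
    simpa using (hp.coeff_pos _ (by simp [Finsupp.degree_cons])).ne'

/-- For admissible `z` the slice has all roots in the open left half-plane, so its logarithmic
derivative at 0 has positive real part. -/
lemma coeff_one (hp : IsPosStable (k + 1) p) :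
    IsPosStable k ((finSuccEquiv ℝ m p).coeff 1) where
  homogeneous := hp.homogeneous.finSuccEquiv_coeff_isHomogeneous 1 k (add_comm _ _)
  coeff_pos d hd := by
    rw [finSuccEquiv_coeff_coeff]
    exact hp.coeff_pos _ (by rw [Finsupp.degree_cons, hd, add_comm])
  ne_zero z hz hz' := by
    rw [← coeff_slice]
    refine Polynomial.coeff_one_ne_zero_of_roots_re_neg
      (by rw [hp.natDegree_slice]; omega) fun t ht => ?_
    rw [eval_slice]
    obtain ⟨i, hi⟩ := hz'
    exact hp.ne_zero _ (Fin.cases (by simpa using ht) (by simpa using hz))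
      ⟨i.succ, by simpa using hi⟩

lemma root_slice (hp : IsPosStable k p) {x : Fin m → ℝ} (hx : ∀ i, 0 < x i) (i₀ : Fin m) {z : ℂ}
    (hz : ((slice x p).map (algebraMap ℝ ℂ)).IsRoot z) : z.im = 0 ∧ z.re < 0 := by
  have hmap : (slice x p).map (algebraMap ℝ ℂ) = slice (fun i => (x i : ℂ)) p := by
    ext j
    rw [Polynomial.coeff_map, coeff_slice, coeff_slice]
    exact (aeval_algebraMap_apply ℂ x _).symm
  rw [hmap, Polynomial.IsRoot, eval_slice] at hz
  have him : z.im = 0 := by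
    by_contra him
    have hlt := Complex.abs_re_lt_norm.2 him
    have hpos : 0 < ‖z‖ + z.re := by linarith [neg_abs_le z.re]
    -- Homogeneity allows rotating the zero. The factor u = |z| + conj z has Re u > 0 and Re(uz) =
    -- |z|(|z| + Re z) ≥ 0, which puts the rotated zero in the forbidden region.
    have hrot := hp.homogeneous.aeval_smul ((‖z‖ : ℂ) + (starRingEnd ℂ) z)
      (Fin.cons z fun i => (x i : ℂ))
    rw [hz, mul_zero] at hrot
    refine hp.ne_zero _ ?_ ⟨i₀.succ, ?_⟩ hrot
    · refine Fin.cases ?_ fun i => ?_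
      · rw [Fin.cons_zero, add_mul, mul_comm ((starRingEnd ℂ) z), Complex.mul_conj,
          Complex.normSq_eq_norm_sq]
        simp only [Complex.add_re, Complex.re_ofReal_mul, Complex.ofReal_re]
        nlinarith [norm_nonneg z]
      · rw [Fin.cons_succ, Complex.re_mul_ofReal]
        simpa using (mul_pos hpos (hx i)).le
    · rw [Fin.cons_succ, Complex.re_mul_ofReal]
      simpa using mul_pos hpos (hx i₀)
  refine ⟨him, ?_⟩
  by_contra hre
  refine hp.ne_zero _ ?_ ⟨i₀.succ, ?_⟩ hz
  · exact Fin.cases (by simpa using hre) fun i => by simpa using (hx i).le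
  · simpa using hx i₀

lemma splits_slice (hp : IsPosStable k p) {x : Fin m → ℝ} (hx : ∀ i, 0 < x i) (i₀ : Fin m) :
    (slice x p).Splits := by
  refine Polynomial.Splits.of_splits_map (algebraMap ℝ ℂ) (IsAlgClosed.splits _) fun z hz => ?_
  exact ⟨z.re, Complex.ext (by simp)
    (by simpa using (hp.root_slice hx i₀ (Polynomial.isRoot_of_mem_roots hz)).1.symm)⟩

lemma capacity_coeff_one (hp : IsPosStable (m + 1) p) {c : ℝ}
    (hc : ∀ x : Fin (m + 1) → ℝ, (∀ i, 0 < x i) → c * ∏ i, x i ≤ aeval x p)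
    (x : Fin m → ℝ) (hx : ∀ i, 0 < x i) :
    c * ((m : ℝ) / (m + 1)) ^ m * ∏ i, x i ≤ aeval x ((finSuccEquiv ℝ m p).coeff 1) := by
  have hc' : ∀ t, 0 < t → c * (∏ i, x i) * t ≤ (slice x p).eval t := fun t ht => by
    rw [eval_slice]
    refine le_trans (le_of_eq ?_) (hc (Fin.cons t x) (Fin.cases (by simpa) (by simpa)))
    rw [Fin.prod_univ_succ]
    simp only [Fin.cons_zero, Fin.cons_succ]
    ring
  rw [← coeff_slice]
  -- For m = 0 no positive coordinate remains to invoke stability, but the slice is just a multiple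
  -- of the variable.
  rcases Nat.eq_zero_or_pos m with rfl | hm
  · have hdeg := hp.natDegree_slice x
    have h0 : (slice x p).coeff 0 = 0 := by
      rw [coeff_slice]
      have : (finSuccEquiv ℝ 0 p).coeff 0 = 0 := by
        ext d
        rw [finSuccEquiv_coeff_coeff, coeff_zero]
        refine hp.homogeneous.coeff_eq_zero ?_
        rw [Finsupp.degree_cons, Subsingleton.elim d 0]
        simp
      rw [this, map_zero]
    have := hc' 1 one_pos
    rw [Polynomial.eval_eq_sum_range, hdeg] at this
    simpa [Finset.sum_range_succ, h0] using this
  · rw [mul_right_comm]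
    refine (hp.splits_slice hx ⟨0, hm⟩).capacity_le_coeff_one hm (hp.natDegree_slice x) ?_ ?_ hc'
    · intro r hr
      have h := hp.root_slice hx ⟨0, hm⟩ (z := r) (by
        have := Polynomial.isRoot_of_mem_roots hr
        exact this.map)
      simpa using h.2
    · rw [Polynomial.leadingCoeff, hp.natDegree_slice, hp.coeff_slice_top]
      exact hp.coeff_pos _ (by simp [Finsupp.degree_cons])

end IsPosStable

/-- Gurvits' capacity inequality. -/
lemma IsPosStable.capacity_le_coeff : ∀ {m : ℕ} {p : MvPolynomial (Fin m) ℝ},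
    IsPosStable m p → ∀ {c : ℝ},
      (∀ x : Fin m → ℝ, (∀ i, 0 < x i) → c * ∏ i, x i ≤ aeval x p) →
        c * (m ! / (m : ℝ) ^ m) ≤ p.coeff (Finsupp.equivFunOnFinite.symm fun _ => 1) := by
  intro m
  induction m with
  | zero =>
    intro p hp c hc
    have := hc (fun _ => 1) fun i => i.elim0
    rw [(MvPolynomial.eq_C_of_isEmpty p)] at this ⊢
    rw [Subsingleton.elim (Finsupp.equivFunOnFinite.symm fun _ : Fin 0 => 1) 0]
    simpa using this
  | succ m ih =>
    intro p hp c hc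
    have h := ih hp.coeff_one (hp.capacity_coeff_one hc)
    rw [finSuccEquiv_coeff_coeff] at h
    have hcons : Finsupp.cons 1 (Finsupp.equivFunOnFinite.symm fun _ : Fin m => 1) =
        (Finsupp.equivFunOnFinite.symm fun _ : Fin (m + 1) => 1) := by
      ext i
      refine Fin.cases ?_ (fun j => ?_) i <;> simp
    rw [hcons] at h
    refine le_trans (le_of_eq ?_) h
    -- The losses (m/(m+1))^m telescope to m!/m^m.
    rw [Nat.factorial_succ, mul_assoc]
    congr 1
    push_cast
    rcases Nat.eq_zero_or_pos m with rfl | hm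
    · simp
    · rw [div_pow, pow_succ]
      field_simp

end Stable

/-! ### Van der Waerden's inequality and the lower bound for avoiding permutations -/

section VanDerWaerden

open MvPolynomial

/-- The linear form with coefficients `a`. -/
noncomputable def linearForm {m : ℕ} (a : Fin m → ℝ) : MvPolynomial (Fin m) ℝ :=
  ∑ j, C (a j) * X j

lemma aeval_linearForm {K : Type*} [CommRing K] [Algebra ℝ K] {m : ℕ} (a : Fin m → ℝ)
    (z : Fin m → K) : aeval z (linearForm a) = ∑ j, algebraMap ℝ K (a j) * z j := by
  simp [linearForm, map_sum]

lemma isHomogeneous_linearForm {m : ℕ} (a : Fin m → ℝ) : (linearForm a).IsHomogeneous 1 :=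
  IsHomogeneous.sum _ _ _ fun j _ => by
    simpa using (isHomogeneous_C (Fin m) (a j)).mul (isHomogeneous_X ℝ j)

lemma IsPosStable.one {m : ℕ} : IsPosStable (m := m) 0 1 where
  homogeneous := isHomogeneous_one _ _
  coeff_pos d hd := by
    rw [(Finsupp.degree_eq_zero_iff d).1 hd]
    simp
  ne_zero z _ _ := by simp

lemma IsPosStable.linearForm_mul {m k : ℕ} {a : Fin m → ℝ} (ha : ∀ j, 0 < a j)
    {p : MvPolynomial (Fin m) ℝ} (hp : IsPosStable k p) :
    IsPosStable (k + 1) (linearForm a * p) where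
  homogeneous := by
    rw [add_comm]
    exact (isHomogeneous_linearForm a).mul hp.homogeneous
  coeff_pos d hd := by
    classical
    have hterm : ∀ j, coeff d (C (a j) * X j * p) =
        a j * if j ∈ d.support then coeff (d - Finsupp.single j 1) p else 0 := fun j => by
      rw [mul_assoc, coeff_C_mul, coeff_X_mul']
    have hdeg : ∀ j ∈ d.support, (d - Finsupp.single j 1).degree = k := fun j hj => by
      have hle : Finsupp.single j 1 ≤ d := by
        rw [Finsupp.single_le_iff]
        exact Nat.one_le_iff_ne_zero.2 (Finsupp.mem_support_iff.1 hj)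
      have h := congrArg Finsupp.degree (tsub_add_cancel_of_le hle)
      rw [map_add, Finsupp.degree_single, hd] at h
      omega
    have hpos : ∀ j ∈ d.support, 0 < coeff d (C (a j) * X j * p) := fun j hj => by
      rw [hterm, if_pos hj]
      exact mul_pos (ha j) (hp.coeff_pos _ (hdeg j hj))
    rw [linearForm, Finset.sum_mul, coeff_sum]
    have hne : d ≠ 0 := by
      rintro rfl
      simp at hd
    obtain ⟨j, hj⟩ := Finsupp.support_nonempty_iff.2 hne
    refine Finset.sum_pos' (fun i _ => ?_) ⟨j, Finset.mem_univ _, hpos j hj⟩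
    by_cases hi : i ∈ d.support
    · exact (hpos i hi).le
    · rw [hterm, if_neg hi, mul_zero]
  ne_zero z hz hz' := by
    rw [map_mul, aeval_linearForm]
    refine mul_ne_zero (fun h => ?_) (hp.ne_zero z hz hz')
    obtain ⟨i, hi⟩ := hz'
    have hre := congrArg Complex.re h
    simp only [Complex.re_sum, Complex.coe_algebraMap, Complex.re_ofReal_mul,
      Complex.zero_re] at hre
    have : 0 < ∑ j, a j * (z j).re :=
      Finset.sum_pos' (fun j _ => mul_nonneg (ha j).le (hz j))
        ⟨i, Finset.mem_univ _, mul_pos (ha i) hi⟩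
    exact this.ne' hre

lemma isPosStable_prod_linearForm {m : ℕ} {ι : Type*} (s : Finset ι) {A : ι → Fin m → ℝ}
    (hA : ∀ i j, 0 < A i j) : IsPosStable s.card (∏ i ∈ s, linearForm (A i)) := by
  classical
  induction s using Finset.induction_on with
  | empty => exact IsPosStable.one
  | insert i s hi ih =>
    rw [Finset.prod_insert hi, Finset.card_insert_of_notMem hi]
    exact ih.linearForm_mul (hA i)

lemma coeff_one_prod_linearForm {m : ℕ} (A : Matrix (Fin m) (Fin m) ℝ) :
    (∏ i, linearForm (A i)).coeff (Finsupp.equivFunOnFinite.symm fun _ => 1) = A.permanent := by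
  classical
  simp only [linearForm]
  rw [Finset.prod_univ_sum, coeff_sum, Fintype.piFinset_univ, ← Matrix.permanent_transpose,
    Matrix.permanent]
  have hterm : ∀ f : Fin m → Fin m, coeff (Finsupp.equivFunOnFinite.symm fun _ => 1)
      (∏ i, C (A i (f i)) * X (R := ℝ) (f i)) =
        if Function.Bijective f then ∏ i, A i (f i) else 0 := by
    intro f
    have hX : (∏ i, X (R := ℝ) (f i)) = monomial (∑ i, Finsupp.single (f i) 1) 1 := by
      rw [monomial_sum_one]
      rfl
    rw [Finset.prod_mul_distrib, ← map_prod, coeff_C_mul, hX, coeff_monomial]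
    have hiff : (∑ i, Finsupp.single (f i) 1 =
        (Finsupp.equivFunOnFinite.symm fun _ => 1 : Fin m →₀ ℕ)) ↔ Function.Bijective f := by
      have hval : ∀ j, (∑ i, Finsupp.single (f i) 1 : Fin m →₀ ℕ) j =
          (Finset.univ.filter fun i => f i = j).card := fun j => by
        rw [Finsupp.finsetSum_apply, Finset.card_filter]
        exact Finset.sum_congr rfl fun i _ => Finsupp.single_apply
      constructor
      · intro h
        refine Finite.surjective_iff_bijective.1 fun j => ?_
        have h1 := DFunLike.congr_fun h j
        rw [hval] at h1
        obtain ⟨i, hi⟩ := Finset.card_pos.1 (by rw [h1]; simp : 0 < _)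
        exact ⟨i, (Finset.mem_filter.1 hi).2⟩
      · intro h
        ext j
        rw [hval]
        obtain ⟨i, hi⟩ := h.surjective j
        have : (Finset.univ.filter fun i => f i = j) = {i} := by
          ext i'
          simp only [Finset.mem_filter, Finset.mem_univ, true_and, Finset.mem_singleton]
          exact ⟨fun h' => h.injective (h'.trans hi.symm), fun h' => h' ▸ hi⟩
        simp [this]
    simp only [hiff, mul_ite, mul_one, mul_zero]
  rw [Finset.sum_congr rfl fun f _ => hterm f, ← Finset.sum_filter]
  symm
  refine Finset.sum_bij (fun (σ : Equiv.Perm (Fin m)) _ => (σ : Fin m → Fin m)) ?_ ?_ ?_ ?_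
  · intro σ _
    exact Finset.mem_filter.2 ⟨Finset.mem_univ _, σ.bijective⟩
  · intro σ _ τ _ h
    exact Equiv.coe_fn_injective h
  · intro f hf
    exact ⟨Equiv.ofBijective f (Finset.mem_filter.1 hf).2, Finset.mem_univ _, rfl⟩
  · intro σ _
    rfl

/-- Capacity at least 1: weighted AM-GM in each row, whose weights sum to 1; multiplying the rows,
the exponent of `x j` is a column sum, again 1. -/
lemma prod_le_prod_linearForm {m : ℕ} {A : Matrix (Fin m) (Fin m) ℝ}
    (hA : A ∈ doublyStochastic ℝ (Fin m)) {x : Fin m → ℝ} (hx : ∀ i, 0 < x i) :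
    ∏ j, x j ≤ ∏ i, ∑ j, A i j * x j := by
  obtain ⟨hnn, hrow, hcol⟩ := mem_doublyStochastic_iff_sum.1 hA
  calc ∏ j, x j = ∏ j, x j ^ (∑ i, A i j) := by simp [hcol]
    _ = ∏ j, ∏ i, x j ^ A i j :=
        Finset.prod_congr rfl fun j _ => Real.rpow_sum_of_pos (hx j) _ _
    _ = ∏ i, ∏ j, x j ^ A i j := Finset.prod_comm
    _ ≤ _ := Finset.prod_le_prod
        (fun i _ => Finset.prod_nonneg fun j _ => Real.rpow_nonneg (hx j).le _)
        fun i _ => Real.geom_mean_le_arith_mean_weighted _ _ _ (fun j _ => hnn i j) (hrow i)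
          fun j _ => (hx j).le

lemma permanent_ge_of_pos {m : ℕ} {A : Matrix (Fin m) (Fin m) ℝ}
    (hA : A ∈ doublyStochastic ℝ (Fin m)) (hpos : ∀ i j, 0 < A i j) :
    (m ! : ℝ) / (m : ℝ) ^ m ≤ A.permanent := by
  have h := isPosStable_prod_linearForm Finset.univ hpos
  rw [Finset.card_univ, Fintype.card_fin] at h
  rw [← coeff_one_prod_linearForm, ← one_mul ((m ! : ℝ) / _)]
  refine h.capacity_le_coeff fun x hx => ?_
  rw [one_mul, map_prod]
  simp only [aeval_linearForm]
  exact prod_le_prod_linearForm hA hx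

/-- The van der Waerden conjecture (Egorychev, Falikman). -/
theorem permanent_ge_of_mem_doublyStochastic {m : ℕ} {A : Matrix (Fin m) (Fin m) ℝ}
    (hA : A ∈ doublyStochastic ℝ (Fin m)) : (m ! : ℝ) / (m : ℝ) ^ m ≤ A.permanent := by
  rcases Nat.eq_zero_or_pos m with rfl | hm
  · simp [Matrix.permanent_isEmpty]
  have hm' : (0 : ℝ) < m := by exact_mod_cast hm
  -- Mixing with the uniform matrix makes all entries positive; continuity of the permanent removes
  -- the perturbation.
  let J : Matrix (Fin m) (Fin m) ℝ := fun _ _ => 1 / m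
  have hJ : J ∈ doublyStochastic ℝ (Fin m) := by
    rw [mem_doublyStochastic_iff_sum]
    refine ⟨fun _ _ => by positivity, fun _ => ?_, fun _ => ?_⟩ <;> simp [J, hm'.ne']
  let B : ℝ → Matrix (Fin m) (Fin m) ℝ := fun ε => (1 - ε) • A + ε • J
  have hB : ∀ ε ∈ Set.Ioo (0 : ℝ) 1, (m ! : ℝ) / (m : ℝ) ^ m ≤ (B ε).permanent := by
    intro ε hε
    have hε' := hε.1
    refine permanent_ge_of_pos (convex_doublyStochastic hA hJ (by linarith [hε.2]) hε.1.le
      (by ring)) fun i j => ?_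
    have h1 : 0 ≤ (1 - ε) * A i j :=
      mul_nonneg (by linarith [hε.2]) (nonneg_of_mem_doublyStochastic hA)
    have h2 : 0 < ε * J i j := by positivity
    simpa [B] using add_pos_of_nonneg_of_pos h1 h2
  have hcont : Continuous fun ε => (B ε).permanent := by
    simp only [Matrix.permanent, B, Matrix.add_apply, Matrix.smul_apply, smul_eq_mul]
    fun_prop
  have hlim : Tendsto (fun ε => (B ε).permanent) (nhdsWithin 0 (Set.Ioi 0)) (nhds A.permanent) := by
    have := (hcont.tendsto 0).mono_left (nhdsWithin_le_nhds (s := Set.Ioi 0))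
    simpa [B] using this
  exact ge_of_tendsto hlim (mem_of_superset (Ioo_mem_nhdsGT one_pos) hB)

/-- Avoiding a `t`-regular pattern: lower bound for the number of permutations. -/
lemma card_avoiding_univ_ge {n t : ℕ} {N : Fin n → Finset (Fin n)} (hrow : ∀ a, (N a).card = t)
    (hcol : ∀ b, (Finset.univ.filter fun a => b ∈ N a).card = t) (ht : t < n) :
    (n ! : ℝ) * (1 - t / n) ^ n ≤ (avoiding N Finset.univ).card := by
  classical
  have hn : (0 : ℝ) < n := by exact_mod_cast (by omega : 0 < n)
  have hnt : (0 : ℝ) < n - t := by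
    rw [sub_pos]; exact_mod_cast ht
  let A : Matrix (Fin n) (Fin n) ℝ := fun b a => if b ∈ N a then 0 else ((n : ℝ) - t)⁻¹
  have hA : A ∈ doublyStochastic ℝ (Fin n) := by
    rw [mem_doublyStochastic_iff_sum]
    refine ⟨fun i j => ?_, fun b => ?_, fun a => ?_⟩
    · simp only [A]; split_ifs <;> positivity
    · have h : (Finset.univ.filter fun a => b ∉ N a).card = n - t := by
        have := Finset.card_filter_add_card_filter_not (s := (Finset.univ : Finset (Fin n)))
          (fun a => b ∈ N a)
        rw [hcol, Finset.card_univ, Fintype.card_fin] at this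
        omega
      simp only [A]
      rw [Finset.sum_ite, Finset.sum_const_zero, zero_add, Finset.sum_const, h, nsmul_eq_mul,
        Nat.cast_sub ht.le, mul_inv_cancel₀ hnt.ne']
    · have h : (Finset.univ.filter fun b => b ∉ N a).card = n - t := by
        have := Finset.card_filter_add_card_filter_not (s := (Finset.univ : Finset (Fin n)))
          (fun b => b ∈ N a)
        rw [Finset.filter_mem_eq_inter, Finset.univ_inter, hrow, Finset.card_univ,
          Fintype.card_fin] at this
        omega
      simp only [A]
      rw [Finset.sum_ite, Finset.sum_const_zero, zero_add, Finset.sum_const, h, nsmul_eq_mul,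
        Nat.cast_sub ht.le, mul_inv_cancel₀ hnt.ne']
  have hper : A.permanent = (avoiding N Finset.univ).card * (((n : ℝ) - t)⁻¹) ^ n := by
    have hterm : ∀ σ : Equiv.Perm (Fin n), ∏ i, A (σ i) i =
        if σ ∈ avoiding N Finset.univ then (((n : ℝ) - t)⁻¹) ^ n else 0 := by
      intro σ
      split_ifs with h
      · rw [mem_avoiding] at h
        rw [Finset.prod_congr rfl fun i hi => if_neg (h i hi), Finset.prod_const,
          Finset.card_univ, Fintype.card_fin]
      · simp only [mem_avoiding, not_forall, not_not] at h
        obtain ⟨i, hi, hi'⟩ := h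
        exact Finset.prod_eq_zero hi (if_pos hi')
    rw [Matrix.permanent, Finset.sum_congr rfl fun σ _ => hterm σ, ← Finset.sum_filter,
      Finset.sum_const, nsmul_eq_mul]
    congr 3
    ext σ
    simp
  have h := permanent_ge_of_mem_doublyStochastic hA
  rw [hper, inv_pow, ← div_eq_mul_inv, le_div_iff₀ (by positivity)] at h
  refine le_trans (le_of_eq ?_) h
  rw [one_sub_div hn.ne', div_pow]
  ring

end VanDerWaerden

/-! ### Extending Latin rectangles by one row -/

section Counting

/-- The entries occurring in column `j` of `R`. -/
def columnEntries {k n : ℕ} (R : Fin k → Equiv.Perm (Fin n)) (j : Fin n) : Finset (Fin n) :=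
  Finset.univ.image fun i => R i j

lemma card_columnEntries {k n : ℕ} {R : Fin k → Equiv.Perm (Fin n)} (hR : IsLatinRectangle R)
    (j : Fin n) : (columnEntries R j).card = k := by
  rw [columnEntries, Finset.card_image_of_injective _ (hR j), Finset.card_univ, Fintype.card_fin]

/-- Each row contains `b` once, and two rows cannot have it in the same column. -/
lemma card_columns_containing {k n : ℕ} {R : Fin k → Equiv.Perm (Fin n)}
    (hR : IsLatinRectangle R) (b : Fin n) :
    (Finset.univ.filter fun j => b ∈ columnEntries R j).card = k := by
  have : (Finset.univ.filter fun j => b ∈ columnEntries R j) =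
      Finset.univ.image fun i => (R i).symm b := by
    ext j
    simp only [columnEntries, Finset.mem_filter, Finset.mem_univ, true_and, Finset.mem_image,
      Equiv.symm_apply_eq]
    exact exists_congr fun i => eq_comm
  rw [this, Finset.card_image_of_injective, Finset.card_univ, Fintype.card_fin]
  intro i i' h
  refine hR ((R i).symm b) ?_
  dsimp only at h ⊢
  rw [Equiv.apply_symm_apply, h, Equiv.apply_symm_apply]

lemma isLatinRectangle_cons {k n : ℕ} (σ : Equiv.Perm (Fin n)) (R : Fin k → Equiv.Perm (Fin n)) :
    IsLatinRectangle (Fin.cons σ R : Fin (k + 1) → Equiv.Perm (Fin n)) ↔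
      IsLatinRectangle R ∧ σ ∈ avoiding (columnEntries R) Finset.univ := by
  have hcomp : ∀ j : Fin n, (fun i : Fin (k + 1) =>
      (Fin.cons σ R : Fin (k + 1) → Equiv.Perm (Fin n)) i j) = Fin.cons (σ j) fun i => R i j := by
    intro j
    ext i
    refine Fin.cases ?_ (fun i => ?_) i <;> simp
  simp only [IsLatinRectangle, hcomp, Fin.cons_injective_iff, mem_avoiding, columnEntries,
    Set.mem_range, Finset.mem_image, Finset.mem_univ, true_and, true_implies]
  rw [forall_and, and_comm]

lemma latinCount_zero (n : ℕ) : latinCount 0 n = 1 := by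
  have : Unique {R : Fin 0 → Equiv.Perm (Fin n) // IsLatinRectangle R} :=
    { default := ⟨Fin.elim0, fun _ i => i.elim0⟩
      uniq := fun R => Subtype.ext (Subsingleton.elim _ _) }
  exact Nat.card_unique

open Classical in
lemma latinCount_succ (k n : ℕ) :
    latinCount (k + 1) n = ∑ R : {R : Fin k → Equiv.Perm (Fin n) // IsLatinRectangle R},
      (avoiding (columnEntries R.1) Finset.univ).card := by
  let e : {R : Fin (k + 1) → Equiv.Perm (Fin n) // IsLatinRectangle R} ≃
      Σ R : {R : Fin k → Equiv.Perm (Fin n) // IsLatinRectangle R},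
        avoiding (columnEntries R.1) Finset.univ :=
    { toFun := fun R =>
        have h := (isLatinRectangle_cons (R.1 0) (Fin.tail R.1)).1
          (by rw [Fin.cons_self_tail]; exact R.2)
        ⟨⟨Fin.tail R.1, h.1⟩, ⟨R.1 0, h.2⟩⟩
      invFun := fun p => ⟨Fin.cons p.2.1 p.1.1, (isLatinRectangle_cons _ _).2 ⟨p.1.2, p.2.2⟩⟩
      left_inv := fun R => Subtype.ext (Fin.cons_self_tail R.1)
      right_inv := fun p => rfl }
  rw [latinCount, Nat.card_congr e, Nat.card_eq_fintype_card, Fintype.card_sigma]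
  simp

open Classical in
lemma card_latinRectangles (k n : ℕ) :
    Fintype.card {R : Fin k → Equiv.Perm (Fin n) // IsLatinRectangle R} = latinCount k n :=
  Nat.card_eq_fintype_card.symm

lemma latinCount_succ_le (k n : ℕ) :
    (latinCount (k + 1) n : ℝ) ≤
      latinCount k n * (n ! * (1 - (k : ℝ) / n + 4 * ((k : ℝ) ^ 2 / (n : ℝ) ^ 2)) ^ n) := by
  classical
  rw [latinCount_succ, Nat.cast_sum]
  refine (Finset.sum_le_card_nsmul _ _
    (n ! * (1 - (k : ℝ) / n + 4 * ((k : ℝ) ^ 2 / (n : ℝ) ^ 2)) ^ n) fun R _ => ?_).trans_eq ?_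
  · simpa using card_avoiding_univ_le (card_columnEntries R.2)
      fun b => (card_columns_containing R.2 b).le
  · rw [Finset.card_univ, card_latinRectangles, nsmul_eq_mul]

lemma latinCount_succ_ge {k n : ℕ} (hk : k < n) :
    latinCount k n * (n ! * (1 - (k : ℝ) / n) ^ n) ≤ (latinCount (k + 1) n : ℝ) := by
  classical
  rw [latinCount_succ, Nat.cast_sum]
  refine le_trans (le_of_eq ?_) (Finset.card_nsmul_le_sum _ _ (n ! * (1 - (k : ℝ) / n) ^ n)
    fun R _ => card_avoiding_univ_ge (card_columnEntries R.2) (card_columns_containing R.2) hk)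
  rw [Finset.card_univ, card_latinRectangles, nsmul_eq_mul]

lemma one_sub_add_four_mul_sq_pos (x : ℝ) : 0 < 1 - x + 4 * x ^ 2 := by
  nlinarith [sq_nonneg (x - 1 / 8)]

lemma prod_Ico_one_eq_prod_range {f : ℕ → ℝ} (hf : f 0 = 1) (k : ℕ) :
    ∏ t ∈ Finset.Ico 1 k, f t = ∏ t ∈ Finset.range k, f t := by
  rcases k with _ | k
  · simp
  · rw [Finset.range_eq_Ico, ← Finset.prod_Ico_consecutive f zero_le_one (Nat.le_add_left 1 k)]
    simp [hf]

lemma latinUpper_eq (k n : ℕ) : latinUpper k n = ∏ t ∈ Finset.range k,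
    (n ! * (1 - (t : ℝ) / n + 4 * ((t : ℝ) ^ 2 / (n : ℝ) ^ 2)) ^ n) := by
  rw [latinUpper, prod_Ico_one_eq_prod_range (by simp), Finset.prod_mul_distrib, Finset.prod_const,
    Finset.card_range]

lemma latinLower_eq (k n : ℕ) : latinLower k n = ∏ t ∈ Finset.range k,
    (n ! * (1 - (t : ℝ) / n) ^ n) := by
  rw [latinLower, prod_Ico_one_eq_prod_range (by simp), Finset.prod_mul_distrib, Finset.prod_const,
    Finset.card_range]

theorem latinCount_le_latinUpper (k n : ℕ) : (latinCount k n : ℝ) ≤ latinUpper k n := by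
  induction k with
  | zero => simp [latinCount_zero, latinUpper]
  | succ k ih =>
    rw [latinUpper_eq, Finset.prod_range_succ, ← latinUpper_eq]
    refine (latinCount_succ_le k n).trans (mul_le_mul_of_nonneg_right ih ?_)
    have := one_sub_add_four_mul_sq_pos ((k : ℝ) / n)
    rw [div_pow] at this
    positivity

theorem latinLower_le_latinCount {k n : ℕ} (hk : k ≤ n) :
    latinLower k n ≤ (latinCount k n : ℝ) := by
  induction k with
  | zero => simp [latinCount_zero, latinLower]
  | succ k ih =>
    rw [latinLower_eq, Finset.prod_range_succ, ← latinLower_eq]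
    refine le_trans (mul_le_mul_of_nonneg_right (ih (by omega)) ?_) (latinCount_succ_ge hk)
    have : (k : ℝ) / n ≤ 1 := div_le_one_of_le₀ (by exact_mod_cast (by omega)) (by positivity)
    have : 0 ≤ 1 - (k : ℝ) / n := by linarith
    positivity

end Counting

/-! ### Comparison of both bounds with the main term -/

section Asymptotic

/-- The leading factor `(n!)^k e^{-k(k-1)/2}`. -/
noncomputable def latinMain (k n : ℕ) : ℝ := (n ! : ℝ) ^ k * Real.exp (-(k.choose 2 : ℝ))

lemma latinMain_pos (k n : ℕ) : 0 < latinMain k n := by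
  unfold latinMain
  positivity

lemma sum_range_sq_le (k : ℕ) : ∑ t ∈ Finset.range k, (t : ℝ) ^ 2 ≤ (k : ℝ) ^ 3 := by
  have : ∀ t ∈ Finset.range k, (t : ℝ) ^ 2 ≤ (k : ℝ) ^ 2 := fun t ht =>
    pow_le_pow_left₀ (Nat.cast_nonneg _) (by exact_mod_cast (Finset.mem_range.1 ht).le) _
  refine (Finset.sum_le_card_nsmul _ _ _ this).trans_eq ?_
  rw [Finset.card_range, nsmul_eq_mul]
  ring

lemma sum_range_cast_eq_choose_two (k : ℕ) :
    ∑ t ∈ Finset.range k, (t : ℝ) = (k.choose 2 : ℝ) := by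
  rw [← Nat.cast_sum, Finset.sum_range_id, Nat.choose_two_right]

lemma latinUpper_le {k n : ℕ} (hn : 0 < n) :
    latinUpper k n ≤ latinMain k n * Real.exp (4 * ((k : ℝ) ^ 3 / n)) := by
  have hn' : (0 : ℝ) < n := by exact_mod_cast hn
  rw [latinUpper_eq]
  have hle : ∀ t ∈ Finset.range k,
      (n ! : ℝ) * (1 - (t : ℝ) / n + 4 * ((t : ℝ) ^ 2 / (n : ℝ) ^ 2)) ^ n ≤
      n ! * Real.exp (-t + 4 * (t ^ 2 / n)) := by
    intro t _
    refine mul_le_mul_of_nonneg_left ?_ (Nat.cast_nonneg _)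
    have hpos := one_sub_add_four_mul_sq_pos ((t : ℝ) / n)
    rw [div_pow] at hpos
    have h1 := Real.add_one_le_exp (-((t : ℝ) / n) + 4 * ((t : ℝ) ^ 2 / (n : ℝ) ^ 2))
    refine (pow_le_pow_left₀ hpos.le (by linarith : _ ≤
      Real.exp (-((t : ℝ) / n) + 4 * ((t : ℝ) ^ 2 / (n : ℝ) ^ 2))) n).trans_eq ?_
    rw [← Real.exp_nat_mul]
    congr 1
    field_simp
  refine (Finset.prod_le_prod (fun t _ => ?_) hle).trans ?_
  · have := one_sub_add_four_mul_sq_pos ((t : ℝ) / n)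
    rw [div_pow] at this
    positivity
  · rw [Finset.prod_mul_distrib, Finset.prod_const, Finset.card_range, ← Real.exp_sum,
      Finset.sum_add_distrib, Finset.sum_neg_distrib, sum_range_cast_eq_choose_two,
      ← Finset.mul_sum, ← Finset.sum_div, Real.exp_add, ← mul_assoc, latinMain]
    have := sum_range_sq_le k
    gcongr

lemma latinLower_ge {k n : ℕ} (hn : 0 < n) (hk : 2 * k ≤ n) :
    latinMain k n * Real.exp (-(4 * ((k : ℝ) ^ 3 / n))) ≤ latinLower k n := by
  have hn' : (0 : ℝ) < n := by exact_mod_cast hn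
  rw [latinLower_eq]
  have hle : ∀ t ∈ Finset.range k, n ! * Real.exp (-t - 4 * (t ^ 2 / n)) ≤
      (n ! : ℝ) * (1 - (t : ℝ) / n) ^ n := by
    intro t ht
    refine mul_le_mul_of_nonneg_left ?_ (Nat.cast_nonneg _)
    have hx : (t : ℝ) / n ≤ 1 / 2 := by
      rw [div_le_iff₀ hn']
      have : ((2 * t : ℕ) : ℝ) ≤ n := by
        have := Finset.mem_range.1 ht
        exact_mod_cast (by omega)
      push_cast at this
      linarith
    have hx0 : 0 ≤ (t : ℝ) / n := by positivity
    have h1 : Real.exp (-((t : ℝ) / n) - 4 * (t / n) ^ 2) ≤ 1 - (t : ℝ) / n := by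
      generalize (t : ℝ) / n = x at hx hx0
      have h2 := Real.add_one_le_exp (x + 4 * x ^ 2)
      have h3 : Real.exp (-x - 4 * x ^ 2) = (Real.exp (x + 4 * x ^ 2))⁻¹ := by
        rw [← Real.exp_neg]; congr 1; ring
      rw [h3]
      refine inv_le_of_inv_le₀ (by linarith) (le_trans ?_ h2)
      rw [inv_le_iff_one_le_mul₀ (by linarith)]
      -- (1 - x)(1 + x + 4x²) = 1 + x²(3 - 4x), which is at least 1 for 0 ≤ x ≤ 1/2.
      nlinarith [mul_nonneg hx0 hx0, mul_nonneg (mul_nonneg hx0 hx0) (by linarith : 0 ≤ 1 / 2 - x)]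
    refine le_trans (le_of_eq ?_) (pow_le_pow_left₀ (Real.exp_pos _).le h1 n)
    rw [← Real.exp_nat_mul]
    congr 1
    field_simp
  refine le_trans ?_ (Finset.prod_le_prod (fun t _ => by positivity) hle)
  rw [Finset.prod_mul_distrib, Finset.prod_const, Finset.card_range, ← Real.exp_sum,
    Finset.sum_sub_distrib, Finset.sum_neg_distrib, sum_range_cast_eq_choose_two,
    ← Finset.mul_sum, ← Finset.sum_div, sub_eq_add_neg, Real.exp_add, ← mul_assoc, latinMain]
  have := sum_range_sq_le k
  gcongr

lemma isEquivalent_latinMain {k : ℕ → ℕ}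
    (hk : Tendsto (fun n => (k n : ℝ) ^ 3 / n) atTop (nhds 0)) {f : ℕ → ℝ}
    (hl : ∀ᶠ n : ℕ in atTop,
      latinMain (k n) n * Real.exp (-(4 * ((k n : ℝ) ^ 3 / n))) ≤ f n)
    (hu : ∀ᶠ n : ℕ in atTop,
      f n ≤ latinMain (k n) n * Real.exp (4 * ((k n : ℝ) ^ 3 / n))) :
    f ~[atTop] fun n => latinMain (k n) n := by
  have h4 : Tendsto (fun n => 4 * ((k n : ℝ) ^ 3 / n)) atTop (nhds 0) := by
    simpa using hk.const_mul 4
  have hexp : Tendsto (fun n => Real.exp (4 * ((k n : ℝ) ^ 3 / n))) atTop (nhds 1) := by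
    simpa [Function.comp_def] using (Real.continuous_exp.tendsto 0).comp h4
  have hexp' : Tendsto (fun n => Real.exp (-(4 * ((k n : ℝ) ^ 3 / n)))) atTop (nhds 1) := by
    simpa [Function.comp_def] using (Real.continuous_exp.tendsto (-0)).comp h4.neg
  rw [isEquivalent_iff_tendsto_one (Eventually.of_forall fun n => (latinMain_pos _ _).ne')]
  refine tendsto_of_tendsto_of_tendsto_of_le_of_le' hexp' hexp ?_ ?_
  · filter_upwards [hl] with n hn
    rw [Pi.div_apply, le_div_iff₀ (latinMain_pos _ _), mul_comm]
    exact hn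
  · filter_upwards [hu] with n hn
    rw [Pi.div_apply, div_le_iff₀ (latinMain_pos _ _), mul_comm]
    exact hn

lemma tendsto_cube_div_of_isLittleO {k : ℕ → ℕ}
    (hk : (fun n : ℕ => (k n : ℝ)) =o[atTop] (fun n : ℕ => (n : ℝ) ^ (1 / 3 : ℝ))) :
    Tendsto (fun n => (k n : ℝ) ^ 3 / n) atTop (nhds 0) := by
  have h := (hk.pow (n := 3) (by norm_num)).tendsto_div_nhds_zero
  refine h.congr fun n => ?_
  rw [← Real.rpow_natCast ((n : ℝ) ^ (1 / 3 : ℝ)), ← Real.rpow_mul (Nat.cast_nonneg _)]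
  norm_num

end Asymptotic

theorem mainTheorem7 :
    (∀ k n : ℕ, 0 < n → (latinCount k n : ℝ) ≤ latinUpper k n) ∧
    (∀ k n : ℕ, 0 < n → k ≤ n → latinLower k n ≤ (latinCount k n : ℝ)) ∧
    (∀ k : ℕ → ℕ,
      (fun n : ℕ => (k n : ℝ)) =o[atTop] (fun n : ℕ => (n : ℝ) ^ (1 / 3 : ℝ)) →
      ((fun n : ℕ => (latinCount (k n) n : ℝ)) ~[atTop] fun n : ℕ => latinUpper (k n) n) ∧
      ((fun n : ℕ => (latinCount (k n) n : ℝ)) ~[atTop] fun n : ℕ =>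
        (n ! : ℝ) ^ k n *
          Real.exp (-((k n).choose 2 : ℝ) - (k n : ℝ) ^ 3 / (6 * (n : ℝ))))) := by
  refine ⟨fun k n _ => latinCount_le_latinUpper k n, fun k n _ hk => latinLower_le_latinCount hk,
    fun k hk => ?_⟩
  have h0 := tendsto_cube_div_of_isLittleO hk
  have hsmall : ∀ᶠ n : ℕ in atTop, 0 < n ∧ 2 * k n ≤ n := by
    filter_upwards [h0.eventually_lt_const (by norm_num : (0 : ℝ) < 1 / 2), eventually_gt_atTop 0]
      with n hn hpos
    refine ⟨hpos, ?_⟩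
    rw [div_lt_iff₀ (by exact_mod_cast hpos)] at hn
    have h1 : (k n : ℝ) ≤ (k n : ℝ) ^ 3 := by
      exact_mod_cast Nat.le_self_pow (by norm_num) (k n)
    have h2 : ((2 * k n : ℕ) : ℝ) ≤ n := by
      push_cast
      linarith
    exact_mod_cast h2
  have hlower : ∀ᶠ n : ℕ in atTop,
      latinMain (k n) n * Real.exp (-(4 * ((k n : ℝ) ^ 3 / n))) ≤ latinCount (k n) n := by
    filter_upwards [hsmall] with n hn
    exact (latinLower_ge hn.1 hn.2).trans (latinLower_le_latinCount (by omega))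
  have hupper : ∀ᶠ n : ℕ in atTop,
      latinUpper (k n) n ≤ latinMain (k n) n * Real.exp (4 * ((k n : ℝ) ^ 3 / n)) := by
    filter_upwards [hsmall] with n hn
    exact latinUpper_le hn.1
  have hL := isEquivalent_latinMain h0 hlower
    (hupper.mono fun n hn => (latinCount_le_latinUpper _ _).trans hn)
  have hU := isEquivalent_latinMain h0
    (hlower.mono fun n hn => hn.trans (latinCount_le_latinUpper _ _)) hupper
  -- The explicit formula is itself in the window, since -4y ≤ -y/6 ≤ 4y for y = k³/n ≥ 0.
  refine ⟨hL.trans hU.symm, hL.trans (IsEquivalent.symm (isEquivalent_latinMain h0 ?_ ?_))⟩ <;>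
  · refine Eventually.of_forall fun n => ?_
    have hx : (0 : ℝ) ≤ (k n : ℝ) ^ 3 / n := by positivity
    have e : (k n : ℝ) ^ 3 / (6 * (n : ℝ)) = (k n : ℝ) ^ 3 / n / 6 := by
      rw [div_div, mul_comm]
    rw [latinMain, mul_assoc, ← Real.exp_add, e]
    refine mul_le_mul_of_nonneg_left (Real.exp_le_exp.2 ?_) (by positivity)
    linarith
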